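/- Fix an integer $n\ge 0$, let $\delta=(n,n-1,\ldots,1)$, and let $\mu\subseteq\delta$ be a partition with conjugate $\mu'$. For partitions $\mu\subseteq\lambda$, a $Q$-tableau of shape $\lambda/\mu$ is a filling of the skew Young diagram $\lambda/\mu$ with letters of the ordered alphabet $1'<1<2'<2<\cdots$ such that rows and columns are weakly increasing, no primed letter appears more than once in any row, and no unprimed letter appears more than once in any column. For such a tableau $T$ let $wt(T)$ be the vector whose $i$-th coordinate is the total number of entries of $T$ equal to $i$ or $i'$, and let $P(T)$ and $U(T)$ be the numbers of primed and of unprimed entries of $T$. Define the formal power series in $\mathbf{x}=(x_1,x_2,\ldots)$ over $\mathbb{Z}[t,r]$ $$Q^{tr}_{\lambda/\mu}=\sum_T \mathbf{x}^{wt(T)}\,t^{P(T)}\,r^{U(T)},$$ where the sum is over all $Q$-tableaux $T$ of shape $\lambda/\mu$. For strict partitions $\beta\subseteq\alpha$ let $Q_{\alpha/\beta}=\sum_T\mathbf{x}^{wt(T)}$ be the skew $Q$-Schur function, where the sum is over all fillings $T$ of the shifted skew diagram $\alpha/\beta$ (row $i$ of the diagram of $\alpha$ being shifted $i-1$ steps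 to the right) that satisfy the same three conditions. Then: 1. $Q^{tr}_{\delta/\mu}$ is symmetric in $t$ and $r$, i.e. it is unchanged when $t$ and $r$ are exchanged; 2. $Q^{tr}_{\delta/\mu}=Q^{tr}_{\delta/\mu'}$; 3. $Q_{(\delta+\delta)/(\mu+\delta)}=Q_{(\delta+\delta)/(\mu'+\delta)}$, where sums of partitions are taken part by part (partitions being padded with zeros). -/

import Mathlib

noncomputable section

namespace QSchur

/-! ### Tableaux in the primed alphabet -/

/-- The ordered alphabet `1' < 1 < 2' < 2 < ⋯`. The letter `(k, false)` is `(k+1)'` and the letter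
`(k, true)` is `k+1`; the order is lexicographic, with `false < true`. -/
abbrev Letter : Type := ℕ ×ₗ Bool

/-- The underlying number of a letter (numbers are indexed from `0`). -/
def Letter.index (a : Letter) : ℕ := (ofLex a).1

/-- The letter carries a prime. -/
def Letter.IsPrimed (a : Letter) : Prop := (ofLex a).2 = false

/-- A filling of a finite set `S` of boxes (matrix coordinates: row, column) by letters of the
alphabet `1' < 1 < 2' < 2 < ⋯` with weakly increasing rows and columns, in which no primed letter
appears twice in a row and no unprimed letter appears twice in a column. -/
@[ext]
structure QTableau (S : Finset (ℕ × ℕ)) where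
  entry : S → Letter
  row_weak : ∀ a b : S, a.1.1 = b.1.1 → a.1.2 < b.1.2 → entry a ≤ entry b
  col_weak : ∀ a b : S, a.1.2 = b.1.2 → a.1.1 < b.1.1 → entry a ≤ entry b
  row_primed : ∀ a b : S, a.1.1 = b.1.1 → a.1.2 < b.1.2 → (entry a).IsPrimed → entry a ≠ entry b
  col_unprimed : ∀ a b : S, a.1.2 = b.1.2 → a.1.1 < b.1.1 → ¬ (entry a).IsPrimed →
    entry a ≠ entry b

namespace QTableau

variable {S : Finset (ℕ × ℕ)}

/-- The weight: coordinate `k` counts the boxes whose entry is the `k`-th number, primed or not. -/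
def wt (T : QTableau S) : ℕ →₀ ℕ := ∑ a : S, Finsupp.single (T.entry a).index 1

/-- The number of primed entries. -/
def numPrimed (T : QTableau S) : ℕ := Nat.card {a : S // (T.entry a).IsPrimed}

/-- The number of unprimed entries. -/
def numUnprimed (T : QTableau S) : ℕ := Nat.card {a : S // ¬ (T.entry a).IsPrimed}

/-- There are finitely many tableaux of a given weight, so the sums below are finite sums. -/
theorem finite_wt_eq (d : ℕ →₀ ℕ) : {T : QTableau S | T.wt = d}.Finite := by
  have hfin : (Set.pi Set.univ fun _ : S =>
      (fun p : ℕ × Bool => (toLex p : Letter)) '' ((d.support : Set ℕ) ×ˢ Set.univ)).Finite :=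
    Set.Finite.pi fun _ => ((d.support.finite_toSet).prod Set.finite_univ).image _
  refine Set.Finite.of_finite_image (f := QTableau.entry) (hfin.subset ?_)
    (fun T _ T' _ h => QTableau.ext h)
  rintro _ ⟨T, hT, rfl⟩ a -
  refine ⟨ofLex (T.entry a), ⟨?_, Set.mem_univ _⟩, rfl⟩
  have hT' : T.wt = d := hT
  rw [Finset.mem_coe, Finsupp.mem_support_iff, ← hT', wt, Finsupp.finsetSum_apply]
  refine (Finset.sum_pos' (fun _ _ => Nat.zero_le _) ⟨a, Finset.mem_univ _, ?_⟩).ne'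
  simp [Letter.index]

end QTableau

/-! ### The function `Q^{tr}` of a skew Young diagram -/

/-- The skew diagram `lam/mu`. -/
def skewCells (lam mu : YoungDiagram) : Finset (ℕ × ℕ) := lam.cells \ mu.cells

/-- The indeterminate `t` of `ℤ[t, r]`. -/
def tVar : MvPolynomial (Fin 2) ℤ := MvPolynomial.X 0

/-- The indeterminate `r` of `ℤ[t, r]`. -/
def rVar : MvPolynomial (Fin 2) ℤ := MvPolynomial.X 1

/-- `Q^{tr}_{lam/mu} = ∑_T x^{wt(T)} t^{P(T)} r^{U(T)}`, a formal power series in the variables `x`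
over `ℤ[t, r]`; the sum is over all tableaux of shape `lam/mu`. It is given by its coefficients. -/
def Qtr (lam mu : YoungDiagram) : MvPowerSeries ℕ (MvPolynomial (Fin 2) ℤ) :=
  fun d => ∑ᶠ T ∈ {T : QTableau (skewCells lam mu) | T.wt = d},
    tVar ^ T.numPrimed * rVar ^ T.numUnprimed

/-- The automorphism of `ℤ[t, r]` that exchanges `t` and `r`. -/
def swapTR : MvPolynomial (Fin 2) ℤ →+* MvPolynomial (Fin 2) ℤ :=
  (MvPolynomial.rename (Equiv.swap (0 : Fin 2) 1)).toRingHom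

/-! ### Skew `Q`-Schur functions of strict partitions -/

/-- A strict partition `parts 0 > parts 1 > ⋯ > parts (l-1) > 0 = parts l = ⋯`. (The subtraction is
truncated: the condition says that a positive part is followed by a smaller one, and a zero part by
a zero part.) -/
structure StrictPartition where
  parts : ℕ → ℕ
  strict : ∀ i, parts (i + 1) ≤ parts i - 1

/-- The shifted diagram: row `i` occupies the columns `i, …, i + parts i - 1`. -/
def StrictPartition.shiftedCells (a : StrictPartition) : Finset (ℕ × ℕ) :=
  (Finset.range (a.parts 0)).biUnion fun i => {i} ×ˢ Finset.Ico i (i + a.parts i)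

theorem StrictPartition.parts_add_le (a : StrictPartition) (i : ℕ) :
    a.parts i ≤ a.parts 0 - i := by
  induction i with
  | zero => simp
  | succ i ih => have := a.strict i; omega

theorem StrictPartition.mem_shiftedCells (a : StrictPartition) (i j : ℕ) :
    (i, j) ∈ a.shiftedCells ↔ i ≤ j ∧ j < i + a.parts i := by
  have := a.parts_add_le i
  simp only [shiftedCells, Finset.mem_biUnion, Finset.mem_range, Finset.mem_product,
    Finset.mem_singleton, Finset.mem_Ico]
  constructor
  · rintro ⟨k, -, rfl, h⟩
    exact h
  · intro h
    exact ⟨i, by omega, rfl, h⟩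

/-- The skew `Q`-Schur function `Q_{a/b} = ∑_T x^{wt(T)}` of strict partitions `b ⊆ a`; the sum is
over the marked shifted tableaux of shifted skew shape `a/b`, with primes allowed on the main
diagonal. It is given by its coefficients. -/
def skewQ (a b : StrictPartition) : MvPowerSeries ℕ ℤ :=
  fun d => (Set.ncard {T : QTableau (a.shiftedCells \ b.shiftedCells) | T.wt = d} : ℤ)

/-! ### Staircases -/

/-- The staircase partition `δ = (n, n-1, …, 1)`. -/
def staircase (n : ℕ) : YoungDiagram where
  cells := (Finset.range n ×ˢ Finset.range n).filter fun c => c.1 + c.2 < n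
  isLowerSet := by
    rintro ⟨i, j⟩ ⟨i', j'⟩ ⟨h1, h2⟩ h
    simp only [Finset.coe_filter, Finset.mem_product, Finset.mem_range, Set.mem_ofPred_eq] at *
    omega

theorem mem_staircase (n i j : ℕ) : (i, j) ∈ staircase n ↔ i + j < n := by
  rw [← YoungDiagram.mem_cells]
  simp only [staircase, Finset.mem_filter, Finset.mem_product, Finset.mem_range]
  omega

theorem rowLen_staircase (n i : ℕ) : (staircase n).rowLen i = n - i := by
  refine eq_of_forall_lt_iff fun j => ?_
  rw [← YoungDiagram.mem_iff_lt_rowLen, mem_staircase]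
  omega

theorem colLen_le_of_le_staircase {n : ℕ} {mu : YoungDiagram} (h : mu ≤ staircase n) :
    mu.colLen 0 ≤ n := by
  by_contra hlt
  have h1 := h (YoungDiagram.mem_iff_lt_colLen.2 (not_le.1 hlt))
  have h2 := (mem_staircase n n 0).1 h1
  omega

theorem transpose_le_staircase {n : ℕ} {mu : YoungDiagram} (h : mu ≤ staircase n) :
    mu.transpose ≤ staircase n := by
  rintro ⟨i, j⟩ hc
  have h1 := (mem_staircase n j i).1 (h (YoungDiagram.mem_transpose.1 hc))
  exact (mem_staircase n i j).2 (by omega)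

/-- The strict partition `lam + δ`, with parts added row by row, for a partition `lam` with at most
`n` rows and `δ = (n, n-1, …, 1)`. -/
def addStaircase (n : ℕ) (lam : YoungDiagram) (h : lam.colLen 0 ≤ n) : StrictPartition where
  parts i := lam.rowLen i + (staircase n).rowLen i
  strict i := by
    have h1 := lam.rowLen_anti i (i + 1) (Nat.le_succ i)
    rw [rowLen_staircase, rowLen_staircase]
    by_cases hi : i < n
    · omega
    · have h0 : lam.rowLen (i + 1) = 0 := by
        by_contra hne
        have h2 : (i + 1, 0) ∈ lam := YoungDiagram.mem_iff_lt_rowLen.2 (Nat.pos_of_ne_zero hne)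
        have h3 := YoungDiagram.mem_iff_lt_colLen.1 h2
        omega
      omega

end QSchur

end

/-! Record, letter by letter, the region filled so far. A tableau of shape `δ/μ` becomes a chain of
partitions from `μ` to `δ` in which an unprimed letter adds a horizontal strip and a primed letter a
vertical one. So the generating function is the `(μ, δ)` entry of a product of transfer matrices
`H(y)` and `V(y)`, indexed by the finitely many partitions inside `δ` (`stripProd_apply`).

The matrices `H(y)` commute by the Bender–Knuth involution (`commute_strip_true`), and `H(y) V(-y) =
1` by a sign-reversing involution (`strip_true_mul_strip_false_neg`), so all the matrices commute
(`commute_strip`). The staircase enters through `isStrip_top`: a strip with outer shape `δ` consists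
of corners of `δ`, so `H(y)` and `V(y)` have the same column at `δ`. Each factor can be moved to the
right end, changed in kind there, and moved back. Hence the entry does not depend on which letters
are primed (`stripProd_apply_top`).

The three claims follow. With all letters made horizontal, the weights `t x_k` of `k'` and `r x_k`
of `k` can be exchanged. Reflection in the diagonal takes `δ/μ` to `δ/μ'` and only exchanges the
kinds of the letters. The shifted diagram `(δ+δ)/(μ+δ)` is a translate of `δ/μ`, so its `Q`-function
is `Q^{tr}` at `t = r = 1`. -/

noncomputable section

namespace QSchur

/-! ### Partitions inside the staircase, by row lengths -/

/-- A partition inside the staircase `(n, n-1, …, 1)`, given by its row lengths. -/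
@[ext]
structure StairRows (n : ℕ) where
  row : ℕ → ℕ
  anti : Antitone row
  row_le : ∀ i, row i ≤ n - i

namespace StairRows

variable {n : ℕ}

instance : Finite (StairRows n) := by
  refine Finite.of_injective
    (fun f : StairRows n => fun i : Fin n => (⟨f.row i, by have := f.row_le i; omega⟩ : Fin (n + 1)))
    fun f g h => StairRows.ext (funext fun i => ?_)
  by_cases hi : i < n
  · simpa using congrFun h ⟨i, hi⟩
  · have := f.row_le i
    have := g.row_le i
    omega

instance : Fintype (StairRows n) := Fintype.ofFinite _

instance : DecidableEq (StairRows n) := Classical.decEq _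

/-- The full staircase. -/
def top (n : ℕ) : StairRows n where
  row i := n - i
  anti _ _ h := by dsimp only; omega
  row_le _ := le_rfl

/-- The number of boxes. -/
def size (f : StairRows n) : ℕ := ∑ i ∈ Finset.range n, f.row i

theorem size_le_size {f g : StairRows n} (h : ∀ i, f.row i ≤ g.row i) : f.size ≤ g.size :=
  Finset.sum_le_sum fun i _ => h i

/-- The skew diagram `g/f` is a horizontal strip. -/
def Horiz (f g : StairRows n) : Prop := ∀ i, f.row i ≤ g.row i ∧ g.row (i + 1) ≤ f.row i

/-- The skew diagram `g/f` is a vertical strip. -/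
def Vert (f g : StairRows n) : Prop := ∀ i, f.row i ≤ g.row i ∧ g.row i ≤ f.row i + 1

/-- The skew diagram `g/f` is a horizontal strip (`k = true`) or a vertical strip
(`k = false`). -/
def IsStrip (k : Bool) (f g : StairRows n) : Prop := if k then Horiz f g else Vert f g

theorem IsStrip.le {k : Bool} {f g : StairRows n} (h : IsStrip k f g) (i : ℕ) :
    f.row i ≤ g.row i := by
  cases k
  · exact (h i).1
  · exact (h i).1

/-! ### Transfer matrices, and commutation of horizontal strips. -/

variable {R : Type*} [CommRing R]

open Classical in
/-- The transfer matrix that adds a strip, each box having weight `y`. -/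
def strip (n : ℕ) (k : Bool) (y : R) : Matrix (StairRows n) (StairRows n) R :=
  fun f g => if IsStrip k f g then y ^ (g.size - f.size) else 0

/-- The upper bounds of the rows of a partition between `f` and `g` that differs from both by
horizontal strips. -/
def upper (f g : StairRows n) : ℕ → ℕ
  | 0 => g.row 0
  | i + 1 => min (g.row (i + 1)) (f.row i)

/-- The lower bounds of the rows of a partition between `f` and `g` that differs from both by
horizontal strips. -/
def lower (f g : StairRows n) (i : ℕ) : ℕ := max (f.row i) (g.row (i + 1))

theorem upper_le (f g : StairRows n) (i : ℕ) : upper f g i ≤ g.row i := by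
  cases i <;> simp [upper]

/-- A maximum and a minimum of the same two numbers add up to their sum: `lower` in row `i` pairs
with `upper` in row `i + 1`. This makes the reflection exchange the sizes of the two strips. -/
theorem sum_lower_add_upper (f g : StairRows n) (k : ℕ) :
    ∑ i ∈ Finset.range k, (lower f g i + upper f g i) + upper f g k =
      ∑ i ∈ Finset.range k, (f.row i + g.row i) + g.row k := by
  induction k with
  | zero => simp [upper]
  | succ k ih =>
    rw [Finset.sum_range_succ, Finset.sum_range_succ]
    have : lower f g k + upper f g (k + 1) = f.row k + g.row (k + 1) := by
      simp only [lower, upper]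
      omega
    omega

theorem Horiz.bounds {f h g : StairRows n} (h₁ : Horiz f h) (h₂ : Horiz h g) (i : ℕ) :
    lower f g i ≤ h.row i ∧ h.row i ≤ upper f g i := by
  refine ⟨max_le (h₁ i).1 (h₂ i).2, ?_⟩
  cases i with
  | zero => exact (h₂ 0).1
  | succ i => exact le_min (h₂ _).1 (h₁ i).2

/-- Together with `Horiz.bounds`: the intermediate shapes form a product of independent intervals,
one for each row, so each row can be reflected separately. -/
theorem horiz_and_horiz_of_bounds {f h g : StairRows n}
    (hb : ∀ i, lower f g i ≤ h.row i ∧ h.row i ≤ upper f g i) : Horiz f h ∧ Horiz h g := by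
  refine ⟨fun i => ⟨(le_max_left _ _).trans (hb i).1, (hb (i + 1)).2.trans (min_le_right _ _)⟩,
    fun i => ⟨(hb i).2.trans (upper_le f g i), (le_max_right _ _).trans (hb i).1⟩⟩

/-- The Bender–Knuth involution: reflect every row in its interval of possible lengths. -/
def reflect {f h g : StairRows n} (h₁ : Horiz f h) (h₂ : Horiz h g) : StairRows n where
  row i := lower f g i + upper f g i - h.row i
  anti := by
    refine antitone_nat_of_succ_le fun i => ?_
    have h3 := h₁.bounds h₂ i
    have h4 := h₁.bounds h₂ (i + 1)
    have h5 : upper f g (i + 1) ≤ f.row i := min_le_right _ _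
    have h6 : f.row i ≤ lower f g i := le_max_left _ _
    omega
  row_le i := by
    have h3 := h₁.bounds h₂ i
    have h4 := upper_le f g i
    have h5 := g.row_le i
    omega

theorem reflect_bounds {f h g : StairRows n} (h₁ : Horiz f h) (h₂ : Horiz h g) (i : ℕ) :
    lower f g i ≤ (reflect h₁ h₂).row i ∧ (reflect h₁ h₂).row i ≤ upper f g i := by
  have h3 := h₁.bounds h₂ i
  simp only [reflect]
  omega

theorem size_reflect {f h g : StairRows n} (h₁ : Horiz f h) (h₂ : Horiz h g) :
    (reflect h₁ h₂).size + h.size = f.size + g.size := by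
  have h3 := sum_lower_add_upper f g n
  have h4 := upper_le f g n
  have h5 := g.row_le n
  have h6 : (reflect h₁ h₂).size + h.size =
      ∑ i ∈ Finset.range n, (lower f g i + upper f g i) := by
    rw [size, size, ← Finset.sum_add_distrib]
    refine Finset.sum_congr rfl fun i _ => ?_
    have h3 := h₁.bounds h₂ i
    simp only [reflect]
    omega
  rw [h6, size, size, ← Finset.sum_add_distrib]
  omega

theorem commute_strip_true (a b : R) : Commute (strip n true a) (strip n true b) := by
  classical
  ext f g
  simp only [Matrix.mul_apply, strip, IsStrip, if_true, mul_ite, ite_mul, zero_mul, mul_zero,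
    ← ite_and]
  rw [← Finset.sum_filter, ← Finset.sum_filter]
  refine Finset.sum_bij' (fun h hh => reflect (Finset.mem_filter.1 hh).2.2 (Finset.mem_filter.1 hh).2.1)
    (fun h hh => reflect (Finset.mem_filter.1 hh).2.2 (Finset.mem_filter.1 hh).2.1) ?_ ?_ ?_ ?_ ?_
  · intro h hh
    simp only [Finset.mem_filter, Finset.mem_univ, true_and] at hh ⊢
    exact (horiz_and_horiz_of_bounds (reflect_bounds hh.2 hh.1)).symm
  · intro h hh
    simp only [Finset.mem_filter, Finset.mem_univ, true_and] at hh ⊢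
    exact (horiz_and_horiz_of_bounds (reflect_bounds hh.2 hh.1)).symm
  · intro h hh
    simp only [Finset.mem_filter, Finset.mem_univ, true_and] at hh
    ext i
    have h3 := hh.2.bounds hh.1 i
    simp only [reflect]
    omega
  · intro h hh
    simp only [Finset.mem_filter, Finset.mem_univ, true_and] at hh
    ext i
    have h3 := hh.2.bounds hh.1 i
    simp only [reflect]
    omega
  · intro h hh
    simp only [Finset.mem_filter, Finset.mem_univ, true_and] at hh
    have h3 := size_reflect hh.2 hh.1
    have h4 := size_le_size fun i => (hh.2 i).1
    have h5 := size_le_size fun i => (hh.1 i).1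
    rw [mul_comm]
    congr 2 <;> omega

/-! ### Horizontal and vertical strips as inverses up to sign. -/

/-- Lengthen or shorten row `i` of `h` so that it differs from the row of `g`, where both `f` and
`h` agree with `g` above row `i`. -/
def toggle {f h g : StairRows n} {i : ℕ} (h₁ : Horiz f h) (h₂ : Vert h g)
    (hlt : f.row i < g.row i) (heq : ∀ j < i, f.row j = g.row j) : StairRows n where
  -- Since `g/h` is a vertical strip, row `i` of `h` has length `g.row i` or `g.row i - 1`; the
  -- formula exchanges these two values.
  row := Function.update h.row i (2 * g.row i - 1 - h.row i)
  anti := by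
    refine antitone_nat_of_succ_le fun j => ?_
    have a1 := h₁ j
    have a2 := h₂ j
    have a3 := h₂ (j + 1)
    have a4 := h.anti (Nat.le_add_right j 1)
    have a5 := g.anti (Nat.le_add_right j 1)
    rcases eq_or_ne j i with rfl | hj
    · rw [Function.update_self, Function.update_of_ne (by omega)]
      omega
    · rw [Function.update_of_ne hj]
      rcases eq_or_ne (j + 1) i with rfl | hj'
      · rw [Function.update_self]
        have := heq j (by omega)
        have := h₁ (j + 1)
        omega
      · rw [Function.update_of_ne hj']
        exact a4
  row_le j := by
    have a2 := h₂ j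
    have a3 := g.row_le j
    rcases eq_or_ne j i with rfl | hj
    · rw [Function.update_self]
      omega
    · rw [Function.update_of_ne hj]
      omega

section toggle

variable {f h g : StairRows n} {i : ℕ} (h₁ : Horiz f h) (h₂ : Vert h g)
    (hlt : f.row i < g.row i) (heq : ∀ j < i, f.row j = g.row j)

theorem toggle_row_self : (toggle h₁ h₂ hlt heq).row i = 2 * g.row i - 1 - h.row i :=
  Function.update_self ..

theorem toggle_row_of_ne {j : ℕ} (hj : j ≠ i) : (toggle h₁ h₂ hlt heq).row j = h.row j :=
  Function.update_of_ne hj ..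

/-- Row `i` stays at least `f.row i` because `f.row i < g.row i`. It stays at most `f.row (i - 1)`
because `f` and `g` agree in that row. -/
theorem horiz_toggle : Horiz f (toggle h₁ h₂ hlt heq) := by
  intro j
  have a1 := h₁ j
  have a2 := h₂ j
  have a3 := h₂ (j + 1)
  have a5 := g.anti (Nat.le_add_right j 1)
  constructor
  · rcases eq_or_ne j i with rfl | hj
    · rw [toggle_row_self]
      omega
    · rw [toggle_row_of_ne _ _ _ _ hj]
      exact a1.1
  · rcases eq_or_ne (j + 1) i with rfl | hj
    · rw [toggle_row_self]
      have := heq j (by omega)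
      omega
    · rw [toggle_row_of_ne _ _ _ _ hj]
      exact a1.2

theorem vert_toggle : Vert (toggle h₁ h₂ hlt heq) g := by
  intro j
  have a2 := h₂ j
  rcases eq_or_ne j i with rfl | hj
  · rw [toggle_row_self]
    omega
  · rw [toggle_row_of_ne _ _ _ _ hj]
    exact a2

theorem size_toggle :
    (toggle h₁ h₂ hlt heq).size + h.row i = h.size + (2 * g.row i - 1 - h.row i) := by
  have hi : i ∈ Finset.range n := by
    have := g.row_le i
    rw [Finset.mem_range]
    omega
  rw [size, size, ← Finset.add_sum_erase _ _ hi, ← Finset.add_sum_erase _ h.row hi,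
    toggle_row_self, Finset.sum_congr rfl fun j hj =>
      toggle_row_of_ne h₁ h₂ hlt heq (Finset.ne_of_mem_erase hj)]
  omega

end toggle

theorem eq_of_horiz_of_vert {f h : StairRows n} (h₁ : Horiz f h) (h₂ : Vert h f) : h = f :=
  StairRows.ext (funext fun i => le_antisymm (h₂ i).1 (h₁ i).1)

/-- Horizontal and vertical strips are inverse to each other up to sign. -/
theorem strip_true_mul_strip_false_neg (a : R) : strip n true a * strip n false (-a) = 1 := by
  classical
  ext f g
  simp only [Matrix.mul_apply, strip, IsStrip, if_true, mul_ite, ite_mul, zero_mul, mul_zero,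
    ← ite_and, Bool.false_eq_true, if_false]
  rw [← Finset.sum_filter]
  rcases eq_or_ne f g with rfl | hfg
  · rw [Matrix.one_apply_eq, Finset.sum_eq_single f]
    · simp
    · intro h hh hne
      rw [Finset.mem_filter] at hh
      exact absurd (eq_of_horiz_of_vert hh.2.2 hh.2.1) hne
    · intro hf
      refine absurd ?_ hf
      rw [Finset.mem_filter]
      exact ⟨Finset.mem_univ _, fun i => ⟨le_rfl, Nat.le_succ _⟩,
        fun i => ⟨le_rfl, f.anti (Nat.le_succ i)⟩⟩
  rw [Matrix.one_apply_ne hfg]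
  by_cases hle : ∀ i, f.row i ≤ g.row i
  swap
  · refine Finset.sum_eq_zero fun h hh => ?_
    rw [Finset.mem_filter] at hh
    exact absurd (fun i => (hh.2.2 i).1.trans (hh.2.1 i).1) hle
  have hex : ∃ i, f.row i < g.row i := by
    by_contra hcon
    push Not at hcon
    exact hfg (StairRows.ext (funext fun i => le_antisymm (hle i) (hcon i)))
  -- The first row in which `f` and `g` differ depends on `f` and `g` only, so toggling there is an
  -- involution on the shapes `h`.
  obtain ⟨i, hlt, heq⟩ : ∃ i, f.row i < g.row i ∧ ∀ j < i, f.row j = g.row j :=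
    ⟨Nat.find hex, Nat.find_spec hex, fun j hj =>
      le_antisymm (hle j) (not_lt.1 (Nat.find_min hex hj))⟩
  refine Finset.sum_involution
    (fun h hh => toggle (Finset.mem_filter.1 hh).2.2 (Finset.mem_filter.1 hh).2.1 hlt heq)
    ?_ ?_ ?_ ?_
  · intro h hh
    simp only [Finset.mem_filter, Finset.mem_univ, true_and] at hh
    have h3 := size_toggle hh.2 hh.1 hlt heq
    have h4 := size_le_size fun i => (hh.2 i).1
    have h5 := size_le_size fun i => (hh.1 i).1
    have h6 := size_le_size fun j => (horiz_toggle hh.2 hh.1 hlt heq j).1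
    have h7 := size_le_size fun j => (vert_toggle hh.2 hh.1 hlt heq j).1
    have h8 := hh.1 i
    generalize (toggle hh.2 hh.1 hlt heq).size = s at *
    -- A toggle moves one box between the horizontal and the vertical strip, which changes the sign
    -- of the term.
    have key : ∀ p q : ℕ, a ^ p * (-a) ^ (q + 1) + a ^ (p + 1) * (-a) ^ q = 0 := by
      intro p q
      ring
    rcases Nat.lt_or_ge s h.size with hs | hs
    · rw [add_comm]
      convert key (s - f.size) (g.size - h.size) using 4 <;> omega
    · convert key (h.size - f.size) (g.size - s) using 4 <;> omega
  · intro h hh _ he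
    have h8 := (Finset.mem_filter.1 hh).2.1 i
    have h9 := congrArg (fun x => x.row i) he
    simp only [toggle_row_self] at h9
    omega
  · intro h hh
    simp only [Finset.mem_filter, Finset.mem_univ, true_and] at hh ⊢
    exact ⟨vert_toggle hh.2 hh.1 hlt heq, horiz_toggle hh.2 hh.1 hlt heq⟩
  · intro h hh
    ext j
    rcases eq_or_ne j i with rfl | hj
    · have h8 := (Finset.mem_filter.1 hh).2.1 j
      have h9 := ((Finset.mem_filter.1 hh).2.2 j).1
      rw [toggle_row_self, toggle_row_self]
      omega
    · rw [toggle_row_of_ne _ _ _ _ hj, toggle_row_of_ne _ _ _ _ hj]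

/-! ### Commutation of all strips, and independence of their kinds at the staircase. -/

theorem commute_of_commute_of_mul_eq_one {M : Type*} [Monoid M] {x y z : M} (h : Commute x y)
    (h₁ : y * z = 1) (h₂ : z * y = 1) : Commute x z :=
  Commute.units_inv_right (u := ⟨y, z, h₁, h₂⟩) h

theorem commute_strip_false_of_commute {x : Matrix (StairRows n) (StairRows n) R}
    (h : ∀ a : R, Commute x (strip n true a)) (b : R) : Commute x (strip n false b) := by
  have h₁ := strip_true_mul_strip_false_neg (n := n) (-b)
  rw [neg_neg] at h₁
  -- The index set is finite, so a one-sided inverse matrix is two-sided.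
  exact commute_of_commute_of_mul_eq_one (h (-b)) h₁ (mul_eq_one_comm.1 h₁)

theorem commute_strip (k l : Bool) (a b : R) : Commute (strip n k a) (strip n l b) := by
  have h : ∀ (k : Bool) (a b : R), Commute (strip n k a) (strip n true b) := by
    intro k a b
    cases k
    · exact (commute_strip_false_of_commute (fun c => commute_strip_true b c) a).symm
    · exact commute_strip_true a b
  cases l
  · exact commute_strip_false_of_commute (h k a) b
  · exact h k a b

/-- A strip at the outer rim of the staircase consists of corners, so it is horizontal as well as
vertical. -/
theorem isStrip_top (k : Bool) (f : StairRows n) :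
    IsStrip k f (top n) ↔ IsStrip true f (top n) := by
  cases k
  swap
  · rfl
  simp only [IsStrip, if_true, Bool.false_eq_true, if_false, Horiz, Vert, top]
  -- Both conditions on row `i` say `n - i - 1 ≤ f.row i`; this is where consecutive parts of `δ`
  -- differing by one is used.
  refine forall_congr' fun i => ?_
  omega

theorem strip_mulVec_top (k : Bool) (a : R) :
    (strip n k a).mulVec (Pi.single (top n) 1) = (strip n true a).mulVec (Pi.single (top n) 1) := by
  ext f
  simp only [Matrix.mulVec_single_one, Matrix.col_apply, strip]
  congr 1
  exact propext (isStrip_top k f)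

/-- The product of the transfer matrices of the letters `0, …, L - 1`. -/
def stripProd (n : ℕ) (k : ℕ → Bool) (w : ℕ → R) : ℕ → Matrix (StairRows n) (StairRows n) R
  | 0 => 1
  | L + 1 => stripProd n k w L * strip n (k L) (w L)

theorem commute_stripProd (k : ℕ → Bool) (w : ℕ → R) (L : ℕ) (l : Bool) (a : R) :
    Commute (stripProd n k w L) (strip n l a) := by
  induction L with
  | zero => exact Commute.one_left _
  | succ L ih => exact ih.mul_left (commute_strip _ _ _ _)

/-- The last factor meets the vector at `δ`, so it can be made horizontal; commuting it past the
others exposes the shorter product to the induction hypothesis. -/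
theorem stripProd_mulVec_top (k : ℕ → Bool) (w : ℕ → R) (L : ℕ) :
    (stripProd n k w L).mulVec (Pi.single (top n) 1) =
      (stripProd n (fun _ => true) w L).mulVec (Pi.single (top n) 1) := by
  induction L with
  | zero => rfl
  | succ L ih =>
    simp only [stripProd]
    rw [← Matrix.mulVec_mulVec, strip_mulVec_top, Matrix.mulVec_mulVec,
      (commute_stripProd k w L true (w L)).eq, ← Matrix.mulVec_mulVec, ih, Matrix.mulVec_mulVec,
      (commute_stripProd (fun _ => true) w L true (w L)).eq]

/-- The generating function of the chains of strips that end at the staircase does not depend on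
the kinds of the strips. -/
theorem stripProd_apply_top (k l : ℕ → Bool) (w : ℕ → R) (L : ℕ) (f : StairRows n) :
    stripProd n k w L f (top n) = stripProd n l w L f (top n) := by
  have h := congrFun ((stripProd_mulVec_top (n := n) k w L).trans (stripProd_mulVec_top l w L).symm) f
  simpa [Matrix.mulVec_single_one] using h

theorem stripProd_swap_weights (l : Bool) (w w' : ℕ → R) (h₀ : ∀ k, w' (2 * k) = w (2 * k + 1))
    (h₁ : ∀ k, w' (2 * k + 1) = w (2 * k)) (m : ℕ) :
    stripProd n (fun _ => l) w' (2 * m) = stripProd n (fun _ => l) w (2 * m) := by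
  induction m with
  | zero => rfl
  | succ m ih =>
    rw [mul_add, mul_one]
    simp only [stripProd]
    rw [ih, h₀, h₁, mul_assoc, mul_assoc, (commute_strip _ _ _ _).eq]

end StairRows

/-! ### Fillings with finitely many letters of prescribed kinds -/

/-- A filling of `S` by the letters `0, …, L - 1`, with weakly increasing rows and columns. A letter
`c` may be repeated in a row only if `k c = true`, and in a column only if `k c = false`. The entries
outside `S` are set to `0`. -/
@[ext]
structure Filling (k : ℕ → Bool) (L : ℕ) (S : Finset (ℕ × ℕ)) where
  entry : ℕ × ℕ → ℕ
  eq_zero : ∀ c ∉ S, entry c = 0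
  lt : ∀ c ∈ S, entry c < L
  row : ∀ i j j', (i, j) ∈ S → (i, j') ∈ S → j < j' →
    entry (i, j) ≤ entry (i, j') ∧ (entry (i, j) = entry (i, j') → k (entry (i, j)) = true)
  col : ∀ i i' j, (i, j) ∈ S → (i', j) ∈ S → i < i' →
    entry (i, j) ≤ entry (i', j) ∧ (entry (i, j) = entry (i', j) → k (entry (i, j)) = false)

namespace Filling

variable {k : ℕ → Bool} {L : ℕ} {S : Finset (ℕ × ℕ)}

instance : Finite (Filling k L S) := by
  refine Finite.of_injective
    (fun T : Filling k L S => fun c : S => (⟨T.entry c, T.lt c c.2⟩ : Fin L))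
    fun T T' h => Filling.ext (funext fun c => ?_)
  by_cases hc : c ∈ S
  · simpa using congrFun h ⟨c, hc⟩
  · rw [T.eq_zero c hc, T'.eq_zero c hc]

instance : Fintype (Filling k L S) := Fintype.ofFinite _

end Filling

variable {R : Type*} [CommRing R]

/-- The generating function of fillings, in which a box with the letter `c` has weight `w c`. -/
def genFun (k : ℕ → Bool) (w : ℕ → R) (L : ℕ) (S : Finset (ℕ × ℕ)) : R :=
  ∑ T : Filling k L S, ∏ c ∈ S, w (T.entry c)

/-- The reflection of a filling in the diagonal, which exchanges the two kinds of letters. -/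
def Filling.reflectDiag {k k' : ℕ → Bool} {L : ℕ} {S S' : Finset (ℕ × ℕ)} (hk : ∀ c, k' c = !k c)
    (hS : ∀ i j, (i, j) ∈ S ↔ (j, i) ∈ S') (T : Filling k L S) : Filling k' L S' where
  entry c := T.entry c.swap
  eq_zero _ hc := T.eq_zero _ fun h => hc ((hS _ _).1 h)
  lt _ hc := T.lt _ ((hS _ _).2 hc)
  row i j j' h h' hlt := by
    simpa [hk] using T.col j j' i ((hS _ _).2 h) ((hS _ _).2 h') hlt
  col i i' j h h' hlt := by
    simpa [hk] using T.row j i i' ((hS _ _).2 h) ((hS _ _).2 h') hlt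

theorem genFun_reflectDiag {k k' : ℕ → Bool} (w : ℕ → R) (L : ℕ) {S S' : Finset (ℕ × ℕ)}
    (hk : ∀ c, k' c = !k c) (hS : ∀ i j, (i, j) ∈ S ↔ (j, i) ∈ S') :
    genFun k w L S = genFun k' w L S' := by
  refine Fintype.sum_bijective (Filling.reflectDiag hk hS) (Function.bijective_iff_has_inverse.2
    ⟨Filling.reflectDiag (fun c => by simp [hk]) (fun i j => (hS j i).symm),
      fun T => rfl, fun T => rfl⟩) _ _ fun T => ?_
  exact Finset.prod_bij' (fun c _ => c.swap) (fun c _ => c.swap) (fun c hc => (hS _ _).1 hc)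
    (fun c hc => (hS _ _).2 hc) (fun _ _ => rfl) (fun _ _ => rfl) fun _ _ => rfl

/-! ### Fillings as chains of strips. -/

namespace StairRows

variable {n : ℕ}

/-- The boxes of the skew diagram `g/f`. -/
def cells (f g : StairRows n) : Finset (ℕ × ℕ) :=
  (Finset.range n ×ˢ Finset.range n).filter fun c => f.row c.1 ≤ c.2 ∧ c.2 < g.row c.1

theorem mem_cells {f g : StairRows n} {i j : ℕ} :
    (i, j) ∈ cells f g ↔ f.row i ≤ j ∧ j < g.row i := by
  have := g.row_le i
  simp only [cells, Finset.mem_filter, Finset.mem_product, Finset.mem_range]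
  omega

theorem card_cells {f g : StairRows n} (h : ∀ i, f.row i ≤ g.row i) :
    (cells f g).card = g.size - f.size := by
  have h₁ : (cells f g).card = ∑ i ∈ Finset.range n, (g.row i - f.row i) := by
    rw [cells, Finset.card_filter, Finset.sum_product]
    refine Finset.sum_congr rfl fun i _ => ?_
    rw [← Finset.card_filter, ← Nat.card_Ico]
    congr 1
    ext j
    have := g.row_le i
    simp only [Finset.mem_filter, Finset.mem_range, Finset.mem_Ico]
    omega
  have h₂ : (cells f g).card + f.size = g.size := by
    rw [h₁, size, size, ← Finset.sum_add_distrib]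
    exact Finset.sum_congr rfl fun i _ => Nat.sub_add_cancel (h i)
  omega

theorem eq_of_lt_iff {f g : StairRows n} (h : ∀ i j, j < f.row i ↔ j < g.row i) : f = g :=
  StairRows.ext (funext fun i => eq_of_forall_lt_iff (h i))

variable {k : ℕ → Bool} {L : ℕ} {f g h : StairRows n}

/-- Extend a filling of `h/f` to a filling of `g/f` by a new largest letter, where `g/h` is a strip
of the kind of this letter. -/
def extend (hf : ∀ i, f.row i ≤ h.row i) (hs : IsStrip (k L) h g) (T : Filling k L (cells f h)) :
    Filling k (L + 1) (cells f g) where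
  entry c := if c ∈ cells h g then L else T.entry c
  eq_zero := by
    rintro ⟨i, j⟩ hc
    have := hs.le i
    rw [mem_cells] at hc
    have := hf i
    rw [if_neg (by rw [mem_cells]; omega)]
    exact T.eq_zero _ (by rw [mem_cells]; omega)
  lt := by
    rintro ⟨i, j⟩ hc
    rw [mem_cells] at hc
    split_ifs with h'
    · omega
    · rw [mem_cells] at h'
      have := T.lt (i, j) (by rw [mem_cells]; omega)
      omega
  row := by
    intro i j j' hj hj' hlt
    rw [mem_cells] at hj hj'
    by_cases h1 : (i, j) ∈ cells h g
    · have h2 : (i, j') ∈ cells h g := by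
        rw [mem_cells] at h1 ⊢
        omega
      rw [if_pos h1, if_pos h2]
      refine ⟨le_rfl, fun _ => ?_⟩
      by_contra hk
      rw [Bool.not_eq_true] at hk
      rw [hk] at hs
      have := hs i
      rw [mem_cells] at h1
      omega
    · have h3 : (i, j) ∈ cells f h := by
        rw [mem_cells] at h1 ⊢
        omega
      rw [if_neg h1]
      by_cases h2 : (i, j') ∈ cells h g
      · rw [if_pos h2]
        have := T.lt _ h3
        omega
      · rw [if_neg h2]
        refine T.row i j j' h3 ?_ hlt
        rw [mem_cells] at h2 ⊢
        omega
  col := by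
    intro i i' j hj hj' hlt
    have ha := h.anti hlt.le
    rw [mem_cells] at hj hj'
    by_cases h1 : (i, j) ∈ cells h g
    · have h2 : (i', j) ∈ cells h g := by
        rw [mem_cells] at h1 ⊢
        omega
      rw [if_pos h1, if_pos h2]
      refine ⟨le_rfl, fun _ => ?_⟩
      by_contra hk
      rw [Bool.not_eq_false] at hk
      rw [hk] at hs
      have := hs i
      have := g.anti (Nat.succ_le_of_lt hlt)
      rw [mem_cells] at h1
      rw [Nat.succ_eq_add_one] at this
      omega
    · have h3 : (i, j) ∈ cells f h := by
        rw [mem_cells] at h1 ⊢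
        omega
      rw [if_neg h1]
      by_cases h2 : (i', j) ∈ cells h g
      · rw [if_pos h2]
        have := T.lt _ h3
        omega
      · rw [if_neg h2]
        refine T.col i i' j h3 ?_ hlt
        rw [mem_cells] at h2 ⊢
        omega

theorem extend_entry (hf : ∀ i, f.row i ≤ h.row i) (hs : IsStrip (k L) h g)
    (T : Filling k L (cells f h)) (c : ℕ × ℕ) :
    (extend hf hs T).entry c = if c ∈ cells h g then L else T.entry c := rfl

/-- The inner shape can be read off the extended filling, which gives injectivity in `genFun_succ`.
-/
theorem lt_row_iff_extend (hf : ∀ i, f.row i ≤ h.row i) (hs : IsStrip (k L) h g)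
    (T : Filling k L (cells f h)) (i j : ℕ) :
    j < h.row i ↔ j < f.row i ∨ (j < g.row i ∧ (extend hf hs T).entry (i, j) < L) := by
  have h1 := hf i
  have h2 := hs.le i
  rw [extend_entry]
  split_ifs with hc
  · rw [mem_cells] at hc
    omega
  · constructor
    · intro hj
      rcases lt_or_ge j (f.row i) with hj' | hj'
      · exact Or.inl hj'
      · exact Or.inr ⟨by omega, T.lt _ (mem_cells.2 ⟨hj', hj⟩)⟩
    · rw [mem_cells] at hc
      omega

theorem exists_inner (hfg : ∀ i, f.row i ≤ g.row i) (T : Filling k (L + 1) (cells f g)) :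
    ∃ h : StairRows n,
      ∀ i j, j < h.row i ↔ j < f.row i ∨ (j < g.row i ∧ T.entry (i, j) < L) := by
  classical
  -- Rows increase weakly, so the boxes with letters below `L` form an initial segment of the row of
  -- `g/f`; the new row length is the first column that fails.
  have hex : ∀ i, ∃ j, ¬ (j < f.row i ∨ (j < g.row i ∧ T.entry (i, j) < L)) := fun i =>
    ⟨g.row i, by have := hfg i; omega⟩
  have hlt : ∀ i j, j < Nat.find (hex i) ↔ j < f.row i ∨ (j < g.row i ∧ T.entry (i, j) < L) := by
    intro i j
    rw [Nat.lt_find_iff]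
    simp only [not_not]
    refine ⟨fun hj => hj j le_rfl, fun hj m hm => ?_⟩
    rcases lt_or_ge m (f.row i) with hm' | hm'
    · exact Or.inl hm'
    · rcases hm.eq_or_lt with rfl | hm
      · exact hj
      · have := T.row i m j (mem_cells.2 ⟨hm', by omega⟩) (mem_cells.2 ⟨by omega, by omega⟩) hm
        omega
  refine ⟨⟨fun i => Nat.find (hex i), ?_, ?_⟩, hlt⟩
  · refine antitone_nat_of_succ_le fun i => le_of_forall_lt fun j hj => ?_
    have h1 := f.anti (Nat.le_add_right i 1)
    have h2 := g.anti (Nat.le_add_right i 1)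
    rw [hlt] at hj ⊢
    rcases lt_or_ge j (f.row i) with hj' | hj'
    · exact Or.inl hj'
    · have := T.col i (i + 1) j (mem_cells.2 ⟨hj', by omega⟩) (mem_cells.2 ⟨by omega, by omega⟩)
        (Nat.lt_succ_self i)
      omega
  · intro i
    refine le_of_forall_lt fun j hj => ?_
    have h1 := f.row_le i
    have h2 := g.row_le i
    rw [hlt] at hj
    omega

/-- All boxes of `g/h` carry `L`. A violation of the strip condition gives two of them in one row
(if `k L = false`) or one column (if `k L = true`), a forbidden repetition. -/
theorem isStrip_of_inner (T : Filling k (L + 1) (cells f g)) (hfg : ∀ i, f.row i ≤ g.row i)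
    (hh : ∀ i j, j < h.row i ↔ j < f.row i ∨ (j < g.row i ∧ T.entry (i, j) < L)) :
    IsStrip (k L) h g := by
  have hle : ∀ i, h.row i ≤ g.row i := fun i => le_of_forall_lt fun j hj => by
    have := hfg i
    rw [hh] at hj
    omega
  have hL : ∀ i j, h.row i ≤ j → j < g.row i → (i, j) ∈ cells f g ∧ T.entry (i, j) = L := by
    intro i j h1 h2
    have h3 := (hh i j).not.1 (by omega)
    have h4 : (i, j) ∈ cells f g := mem_cells.2 (by omega)
    have := T.lt _ h4
    exact ⟨h4, by omega⟩
  cases hk : k L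
  · refine fun i => ⟨hle i, ?_⟩
    by_contra hcon
    have h1 := hL i (h.row i) le_rfl (by omega)
    have h2 := hL i (h.row i + 1) (by omega) (by omega)
    have h3 := (T.row i _ _ h1.1 h2.1 (by omega)).2 (h1.2.trans h2.2.symm)
    rw [h1.2, hk] at h3
    exact Bool.false_ne_true h3
  · refine fun i => ⟨hle i, ?_⟩
    by_contra hcon
    have h0 := g.anti (Nat.le_add_right i 1)
    have h0' := h.anti (Nat.le_add_right i 1)
    have h1 := hL i (h.row i) le_rfl (by omega)
    have h2 := hL (i + 1) (h.row i) (by omega) (by omega)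
    have h3 := (T.col i _ _ h1.1 h2.1 (by omega)).2 (h1.2.trans h2.2.symm)
    rw [h1.2, hk] at h3
    exact Bool.false_ne_true h3.symm

theorem exists_extend_eq (hfg : ∀ i, f.row i ≤ g.row i) (T : Filling k (L + 1) (cells f g)) :
    ∃ (h : StairRows n) (hf : ∀ i, f.row i ≤ h.row i) (hs : IsStrip (k L) h g)
      (T' : Filling k L (cells f h)), extend hf hs T' = T := by
  obtain ⟨h, hh⟩ := exists_inner hfg T
  have hs := isStrip_of_inner T hfg hh
  have hf : ∀ i, f.row i ≤ h.row i := fun i =>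
    le_of_forall_lt fun j hj => (hh i j).2 (Or.inl hj)
  have hsub : ∀ i j, (i, j) ∈ cells f h → (i, j) ∈ cells f g := by
    intro i j hc
    have := hs.le i
    rw [mem_cells] at hc ⊢
    omega
  refine ⟨h, hf, hs, ⟨fun c => if c ∈ cells f h then T.entry c else 0, ?_, ?_, ?_, ?_⟩, ?_⟩
  · exact fun c hc => if_neg hc
  · rintro ⟨i, j⟩ hc
    rw [if_pos hc]
    rw [mem_cells] at hc
    have := (hh i j).1 hc.2
    omega
  · intro i j j' hj hj' hlt
    rw [if_pos hj, if_pos hj']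
    exact T.row i j j' (hsub _ _ hj) (hsub _ _ hj') hlt
  · intro i i' j hj hj' hlt
    rw [if_pos hj, if_pos hj']
    exact T.col i i' j (hsub _ _ hj) (hsub _ _ hj') hlt
  · ext ⟨i, j⟩
    rw [extend_entry]
    dsimp only
    have h1 := hf i
    have h2 := hs.le i
    have h3 := hh i j
    by_cases hc : (i, j) ∈ cells f g
    · have := T.lt _ hc
      split_ifs with h4 h5
      · rw [mem_cells] at h4
        omega
      · rfl
      · rw [mem_cells] at hc h4 h5
        omega
    · have := T.eq_zero _ hc
      rw [mem_cells] at hc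
      rw [if_neg (by rw [mem_cells]; omega)]
      split_ifs <;> omega

theorem prod_extend (w : ℕ → R) (hf : ∀ i, f.row i ≤ h.row i) (hs : IsStrip (k L) h g)
    (T : Filling k L (cells f h)) :
    ∏ c ∈ cells f g, w ((extend hf hs T).entry c) =
      (∏ c ∈ cells f h, w (T.entry c)) * w L ^ (g.size - h.size) := by
  have hd : Disjoint (cells f h) (cells h g) := by
    rw [Finset.disjoint_left]
    rintro ⟨i, j⟩ h1 h2
    rw [mem_cells] at h1 h2
    omega
  have hu : cells f g = cells f h ∪ cells h g := by
    ext ⟨i, j⟩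
    have h1 := hf i
    have h2 := hs.le i
    rw [Finset.mem_union, mem_cells, mem_cells, mem_cells]
    omega
  rw [Finset.prod_congr hu fun _ _ => rfl, Finset.prod_union hd, ← card_cells hs.le]
  congr 1
  · refine Finset.prod_congr rfl fun c hc => ?_
    rw [extend_entry, if_neg (Finset.disjoint_left.1 hd hc)]
  · refine Finset.prod_eq_pow_card fun c hc => ?_
    rw [extend_entry, if_pos hc]

open Classical in
/-- Removing the boxes with the largest letter. -/
theorem genFun_succ (w : ℕ → R) (hfg : ∀ i, f.row i ≤ g.row i) :
    genFun k w (L + 1) (cells f g) =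
      ∑ h : {h : StairRows n // (∀ i, f.row i ≤ h.row i) ∧ IsStrip (k L) h g},
        genFun k w L (cells f h.1) * w L ^ (g.size - h.1.size) := by
  simp only [genFun, Finset.sum_mul]
  rw [← Fintype.sum_sigma']
  refine (Fintype.sum_bijective (fun x => extend x.1.2.1 x.1.2.2 x.2) ⟨?_, ?_⟩ _ _ ?_).symm
  · rintro ⟨⟨h, hf, hs⟩, T⟩ ⟨⟨h', hf', hs'⟩, T'⟩ heq
    dsimp only at heq
    obtain rfl : h = h' := eq_of_lt_iff fun i j => by
      rw [lt_row_iff_extend hf hs T, lt_row_iff_extend hf' hs' T', heq]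
    obtain rfl : T = T' := by
      ext ⟨i, j⟩
      by_cases hc : (i, j) ∈ cells f h
      · have h1 := congrFun (congrArg Filling.entry heq) (i, j)
        rw [extend_entry, extend_entry, if_neg, if_neg] at h1
        · exact h1
        all_goals
          rw [mem_cells] at hc ⊢
          omega
      · rw [T.eq_zero _ hc, T'.eq_zero _ hc]
    rfl
  · intro T
    obtain ⟨h, hf, hs, T', rfl⟩ := exists_extend_eq hfg T
    exact ⟨⟨⟨h, hf, hs⟩, T'⟩, rfl⟩
  · rintro ⟨⟨h, hf, hs⟩, T⟩
    exact (prod_extend w hf hs T).symm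

theorem genFun_zero (w : ℕ → R) (hfg : ∀ i, f.row i ≤ g.row i) :
    genFun k w 0 (cells f g) = (1 : Matrix (StairRows n) (StairRows n) R) f g := by
  rcases eq_or_ne f g with rfl | hne
  · have he : cells f f = ∅ := by
      ext ⟨i, j⟩
      simp [mem_cells]
    rw [he, Matrix.one_apply_eq, genFun]
    have : Unique (Filling k 0 (∅ : Finset (ℕ × ℕ))) :=
      { default := ⟨fun _ => 0, by simp, by simp, by simp, by simp⟩
        uniq := fun T => Filling.ext (funext fun c => T.eq_zero c (Finset.notMem_empty c)) }
    simp
  · rw [Matrix.one_apply_ne hne, genFun]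
    refine Finset.sum_eq_zero fun T _ => ?_
    obtain ⟨i, hi⟩ : ∃ i, f.row i ≠ g.row i := by
      by_contra hcon
      push Not at hcon
      exact hne (StairRows.ext (funext hcon))
    have := hfg i
    exact absurd (T.lt (i, f.row i) (mem_cells.2 (by omega))) (Nat.not_lt_zero _)

theorem strip_eq_zero {l : Bool} {a : R} (hs : ¬ IsStrip l f g) : strip n l a f g = 0 :=
  if_neg hs

theorem strip_eq_pow {l : Bool} {a : R} (hs : IsStrip l f g) :
    strip n l a f g = a ^ (g.size - f.size) :=
  if_pos hs

/-- The matrix product sums over all intermediate shapes; this discards those that do not contain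
`f`. -/
theorem stripProd_eq_zero (k : ℕ → Bool) (w : ℕ → R) (L : ℕ) {f g : StairRows n}
    (hfg : ¬ ∀ i, f.row i ≤ g.row i) : stripProd n k w L f g = 0 := by
  induction L generalizing g with
  | zero => exact Matrix.one_apply_ne fun h => hfg fun i => h ▸ le_rfl
  | succ L ih =>
    rw [stripProd, Matrix.mul_apply]
    refine Finset.sum_eq_zero fun h _ => ?_
    by_cases hs : IsStrip (k L) h g
    · rw [ih fun hfh => hfg fun i => (hfh i).trans (hs.le i), zero_mul]
    · rw [strip_eq_zero hs, mul_zero]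

/-- The generating function of fillings is an entry of a product of transfer matrices. -/
theorem stripProd_apply (k : ℕ → Bool) (w : ℕ → R) (L : ℕ) {f g : StairRows n}
    (hfg : ∀ i, f.row i ≤ g.row i) : stripProd n k w L f g = genFun k w L (cells f g) := by
  classical
  induction L generalizing g with
  | zero => exact (genFun_zero w hfg).symm
  | succ L ih =>
    rw [genFun_succ w hfg, stripProd, Matrix.mul_apply,
      ← Finset.sum_subset (Finset.filter_subset
        (fun h : StairRows n => (∀ i, f.row i ≤ h.row i) ∧ IsStrip (k L) h g) Finset.univ),
      Finset.sum_subtype _ (p := fun h : StairRows n =>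
        (∀ i, f.row i ≤ h.row i) ∧ IsStrip (k L) h g) (by simp)]
    · refine Finset.sum_congr rfl fun h _ => ?_
      rw [ih h.2.1, strip_eq_pow h.2.2]
    · intro h _ hh
      by_cases hfh : ∀ i, f.row i ≤ h.row i
      · rw [strip_eq_zero fun hs => hh (by simp [hfh, hs]), mul_zero]
      · rw [stripProd_eq_zero k w L hfh, zero_mul]

/-- For a diagram `δ/f`, the generating function does not depend on the kinds of the letters. -/
theorem genFun_cells_top (k l : ℕ → Bool) (w : ℕ → R) (L : ℕ) (f : StairRows n) :
    genFun k w L (cells f (top n)) = genFun l w L (cells f (top n)) := by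
  rw [← stripProd_apply k w L f.row_le, stripProd_apply_top k l, stripProd_apply l w L f.row_le]

/-- Once all letters are horizontal, the neighbours `2 * c` and `2 * c + 1` differ only in weight,
and their matrices commute. -/
theorem genFun_cells_top_swap_weights (k : ℕ → Bool) (w w' : ℕ → R)
    (h₀ : ∀ c, w' (2 * c) = w (2 * c + 1)) (h₁ : ∀ c, w' (2 * c + 1) = w (2 * c)) (m : ℕ)
    (f : StairRows n) :
    genFun k w' (2 * m) (cells f (top n)) = genFun k w (2 * m) (cells f (top n)) := by
  rw [genFun_cells_top k (fun _ => true), genFun_cells_top k (fun _ => true),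
    ← stripProd_apply _ _ _ f.row_le, ← stripProd_apply _ _ _ f.row_le,
    stripProd_swap_weights true w w' h₀ h₁]

end StairRows

/-! ### Marked tableaux as fillings -/

/-- The position of a letter in the alphabet `1' < 1 < 2' < 2 < ⋯`. -/
def Letter.code (a : Letter) : ℕ := 2 * (ofLex a).1 + (ofLex a).2.toNat

/-- The letter at a given position in the alphabet. -/
def Letter.decode (c : ℕ) : Letter := toLex (c / 2, decide (c % 2 = 1))

/-- The kind of a letter: `true` if it is unprimed. -/
def letterKind (c : ℕ) : Bool := decide (c % 2 = 1)

theorem Letter.code_decode (c : ℕ) : (Letter.decode c).code = c := by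
  rcases Nat.mod_two_eq_zero_or_one c with h | h <;> simp [code, decode, h] <;> omega

theorem Letter.code_div_two (a : Letter) : a.code / 2 = a.index := by
  obtain ⟨⟨i, _ | _⟩, rfl⟩ := toLex.surjective a <;> simp [code, index]
  omega

theorem Letter.code_mod_two (a : Letter) : a.code % 2 = 0 ↔ a.IsPrimed := by
  obtain ⟨⟨i, _ | _⟩, rfl⟩ := toLex.surjective a <;> simp [code, IsPrimed]

theorem Letter.decode_code (a : Letter) : Letter.decode a.code = a := by
  obtain ⟨⟨i, _ | _⟩, rfl⟩ := toLex.surjective a <;> simp [code, decode]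
  omega

theorem Letter.code_injective : Function.Injective Letter.code :=
  Function.LeftInverse.injective Letter.decode_code

theorem Letter.code_le_code {a b : Letter} : a.code ≤ b.code ↔ a ≤ b := by
  rw [Prod.Lex.le_iff]
  obtain ⟨⟨i, _ | _⟩, rfl⟩ := toLex.surjective a <;>
    obtain ⟨⟨j, _ | _⟩, rfl⟩ := toLex.surjective b <;> simp [code] <;> omega

theorem letterKind_code_eq_true {a : Letter} : letterKind a.code = true ↔ ¬ a.IsPrimed := by
  rw [← Letter.code_mod_two, letterKind, decide_eq_true_iff]
  omega

theorem letterKind_code_eq_false {a : Letter} : letterKind a.code = false ↔ a.IsPrimed := by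
  rw [← not_iff_not, Bool.not_eq_false, letterKind_code_eq_true]

variable {S : Finset (ℕ × ℕ)}

/-- A marked tableau with letters of index less than `m` as a filling. -/
def QTableau.toFilling (T : QTableau S) {m : ℕ} (hT : ∀ a, (T.entry a).index < m) :
    Filling letterKind (2 * m) S where
  entry c := if h : c ∈ S then (T.entry ⟨c, h⟩).code else 0
  eq_zero c hc := dif_neg hc
  lt c hc := by
    have := hT ⟨c, hc⟩
    rw [← Letter.code_div_two] at this
    rw [dif_pos hc]
    omega
  row i j j' h h' hlt := by
    rw [dif_pos h, dif_pos h', Letter.code_le_code, Letter.code_injective.eq_iff,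
      letterKind_code_eq_true]
    exact ⟨T.row_weak ⟨_, h⟩ ⟨_, h'⟩ rfl hlt,
      fun he hp => T.row_primed ⟨_, h⟩ ⟨_, h'⟩ rfl hlt hp he⟩
  col i i' j h h' hlt := by
    rw [dif_pos h, dif_pos h', Letter.code_le_code, Letter.code_injective.eq_iff,
      letterKind_code_eq_false]
    exact ⟨T.col_weak ⟨_, h⟩ ⟨_, h'⟩ rfl hlt,
      fun he => by_contra fun hp => T.col_unprimed ⟨_, h⟩ ⟨_, h'⟩ rfl hlt hp he⟩

theorem QTableau.toFilling_entry (T : QTableau S) {m : ℕ} (hT : ∀ a, (T.entry a).index < m)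
    (a : S) : (T.toFilling hT).entry a = (T.entry a).code :=
  dif_pos a.2

/-- The marked tableau of a filling. -/
def Filling.toQTableau {L : ℕ} (T : Filling letterKind L S) : QTableau S where
  entry a := Letter.decode (T.entry a)
  row_weak := by
    rintro ⟨⟨i, j⟩, h⟩ ⟨⟨i', j'⟩, h'⟩ rfl hlt
    rw [← Letter.code_le_code, Letter.code_decode, Letter.code_decode]
    exact (T.row _ _ _ h h' hlt).1
  col_weak := by
    rintro ⟨⟨i, j⟩, h⟩ ⟨⟨i', j'⟩, h'⟩ rfl hlt
    rw [← Letter.code_le_code, Letter.code_decode, Letter.code_decode]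
    exact (T.col _ _ _ h h' hlt).1
  row_primed := by
    rintro ⟨⟨i, j⟩, h⟩ ⟨⟨i', j'⟩, h'⟩ rfl hlt hp he
    rw [← Letter.code_injective.eq_iff, Letter.code_decode, Letter.code_decode] at he
    rw [← letterKind_code_eq_false, Letter.code_decode, (T.row _ _ _ h h' hlt).2 he] at hp
    exact Bool.false_ne_true hp.symm
  col_unprimed := by
    rintro ⟨⟨i, j⟩, h⟩ ⟨⟨i', j'⟩, h'⟩ rfl hlt hp he
    rw [← Letter.code_injective.eq_iff, Letter.code_decode, Letter.code_decode] at he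
    rw [← letterKind_code_eq_true, Letter.code_decode, (T.col _ _ _ h h' hlt).2 he] at hp
    exact Bool.false_ne_true hp

/-! ### Weights, and truncation to finitely many letters. -/

theorem QTableau.index_mem_support (T : QTableau S) (a : S) :
    (T.entry a).index ∈ T.wt.support := by
  rw [Finsupp.mem_support_iff, wt, Finsupp.finsetSum_apply]
  refine (Finset.sum_pos' (fun _ _ => Nat.zero_le _) ⟨a, Finset.mem_univ _, ?_⟩).ne'
  simp

/-- The scalar weight of a letter: `t` if it is primed, and `r` otherwise. -/
def markWeight (c : ℕ) : MvPolynomial (Fin 2) ℤ := if c % 2 = 0 then tVar else rVar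

/-- The weight of a letter: `t x_k` for the letter `k'` and `r x_k` for the letter `k`. -/
def letterWeight (c : ℕ) : MvPowerSeries ℕ (MvPolynomial (Fin 2) ℤ) :=
  MvPowerSeries.monomial (Finsupp.single (c / 2) 1) (markWeight c)

theorem prod_monomial {ι σ A : Type*} [CommSemiring A] (s : Finset ι) (e : ι → σ →₀ ℕ)
    (a : ι → A) :
    ∏ i ∈ s, MvPowerSeries.monomial (e i) (a i) =
      MvPowerSeries.monomial (∑ i ∈ s, e i) (∏ i ∈ s, a i) := by
  classical
  induction s using Finset.induction_on with
  | empty => simp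
  | insert i s hi ih =>
    rw [Finset.prod_insert hi, Finset.prod_insert hi, Finset.sum_insert hi, ih,
      MvPowerSeries.monomial_mul_monomial]

theorem QTableau.wt_eq_sum_code (T : QTableau S) :
    T.wt = ∑ a : S, Finsupp.single ((T.entry a).code / 2) 1 := by
  simp only [wt, Letter.code_div_two]

theorem QTableau.prod_markWeight (T : QTableau S) :
    ∏ a : S, markWeight (T.entry a).code = tVar ^ T.numPrimed * rVar ^ T.numUnprimed := by
  classical
  simp only [markWeight, Letter.code_mod_two]
  rw [Finset.prod_ite, Finset.prod_const, Finset.prod_const, numPrimed, numUnprimed,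
    Nat.card_eq_fintype_card, Nat.card_eq_fintype_card, Fintype.card_subtype,
    Fintype.card_subtype]

theorem Filling.wt_toQTableau {L : ℕ} (T : Filling letterKind L S) :
    T.toQTableau.wt = ∑ c ∈ S, Finsupp.single (T.entry c / 2) 1 := by
  rw [QTableau.wt_eq_sum_code, ← Finset.sum_coe_sort S]
  simp only [toQTableau, Letter.code_decode]

theorem QTableau.toQTableau_toFilling (T : QTableau S) {m : ℕ}
    (hT : ∀ a, (T.entry a).index < m) : (T.toFilling hT).toQTableau = T := by
  ext a
  simp only [Filling.toQTableau, toFilling_entry, Letter.decode_code]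

/-- The generating function of the marked tableaux of weight `d` is a coefficient of a generating
function of fillings. -/
theorem coeff_genFun (S : Finset (ℕ × ℕ)) (d : ℕ →₀ ℕ) {m : ℕ} (hm : ∀ i ∈ d.support, i < m) :
    MvPowerSeries.coeff d (genFun letterKind letterWeight (2 * m) S) =
      ∑ᶠ T ∈ {T : QTableau S | T.wt = d}, tVar ^ T.numPrimed * rVar ^ T.numUnprimed := by
  classical
  have hT : ∀ T : QTableau S, T.wt = d → ∀ a, (T.entry a).index < m := by
    rintro T rfl a
    exact hm _ (T.index_mem_support a)
  rw [finsum_mem_eq_finite_toFinset_sum _ (QTableau.finite_wt_eq d), genFun, map_sum]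
  simp only [letterWeight, prod_monomial, MvPowerSeries.coeff_monomial]
  rw [← Finset.sum_filter]
  refine Finset.sum_bij' (fun T _ => T.toQTableau)
    (fun T hh => T.toFilling (hT T ((QTableau.finite_wt_eq d).mem_toFinset.1 hh))) ?_ ?_ ?_ ?_ ?_
  · intro T hh
    rw [Set.Finite.mem_toFinset]
    exact T.wt_toQTableau.trans (Finset.mem_filter.1 hh).2.symm
  · intro T hh
    rw [Finset.mem_filter]
    refine ⟨Finset.mem_univ _, ?_⟩
    rw [← Filling.wt_toQTableau, QTableau.toQTableau_toFilling]
    exact ((QTableau.finite_wt_eq d).mem_toFinset.1 hh).symm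
  · intro T hh
    ext c
    by_cases hc : c ∈ S
    · rw [QTableau.toFilling_entry _ _ ⟨c, hc⟩]
      exact Letter.code_decode _
    · rw [Filling.eq_zero _ c hc, Filling.eq_zero _ c hc]
  · intro T hh
    exact T.toQTableau_toFilling _
  · intro T hh
    rw [← QTableau.prod_markWeight, ← Finset.prod_coe_sort S]
    simp only [Filling.toQTableau, Letter.code_decode]

theorem exists_forall_mem_support_lt (d : ℕ →₀ ℕ) : ∃ m, ∀ i ∈ d.support, i < m :=
  ⟨d.support.sup id + 1, fun _ hi => Nat.lt_succ_of_le (Finset.le_sup (f := id) hi)⟩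

theorem coeff_Qtr (lam mu : YoungDiagram) (d : ℕ →₀ ℕ) {m : ℕ} (hm : ∀ i ∈ d.support, i < m) :
    MvPowerSeries.coeff d (Qtr lam mu) =
      MvPowerSeries.coeff d (genFun letterKind letterWeight (2 * m) (skewCells lam mu)) :=
  (coeff_genFun _ d hm).symm

theorem map_genFun {A B : Type*} [CommRing A] [CommRing B] (φ : A →+* B) (k : ℕ → Bool)
    (w : ℕ → A) (L : ℕ) (S : Finset (ℕ × ℕ)) :
    φ (genFun k w L S) = genFun k (fun c => φ (w c)) L S := by
  simp only [genFun, map_sum, map_prod]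

/-! ### Diagrams inside the staircase -/

/-- The row lengths of a Young diagram inside the staircase. -/
def StairRows.ofDiagram {n : ℕ} {mu : YoungDiagram} (h : mu ≤ staircase n) : StairRows n where
  row i := mu.rowLen i
  anti := fun i j hij => mu.rowLen_anti i j hij
  row_le i := le_of_forall_lt fun j hj => by
    have := (mem_staircase n i j).1 (h (YoungDiagram.mem_iff_lt_rowLen.2 hj))
    omega

theorem mem_skewCells_staircase {n : ℕ} {mu : YoungDiagram} {i j : ℕ} :
    (i, j) ∈ skewCells (staircase n) mu ↔ i + j < n ∧ mu.rowLen i ≤ j := by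
  rw [skewCells, Finset.mem_sdiff, YoungDiagram.mem_cells, YoungDiagram.mem_cells, mem_staircase,
    YoungDiagram.mem_iff_lt_rowLen, not_lt]

theorem cells_ofDiagram {n : ℕ} {mu : YoungDiagram} (h : mu ≤ staircase n) :
    StairRows.cells (StairRows.ofDiagram h) (StairRows.top n) = skewCells (staircase n) mu := by
  ext ⟨i, j⟩
  rw [StairRows.mem_cells, mem_skewCells_staircase]
  simp only [StairRows.ofDiagram, StairRows.top]
  omega

theorem mem_skewCells_transpose {n : ℕ} {mu : YoungDiagram} {i j : ℕ} :
    (i, j) ∈ skewCells (staircase n) mu.transpose ↔ (j, i) ∈ skewCells (staircase n) mu := by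
  simp only [skewCells, Finset.mem_sdiff, YoungDiagram.mem_cells, mem_staircase,
    YoungDiagram.mem_transpose, Prod.swap_prod_mk, add_comm]

theorem swapTR_markWeight_even (c : ℕ) : swapTR (markWeight (2 * c)) = markWeight (2 * c + 1) := by
  simp [markWeight, swapTR, tVar, rVar, Nat.add_mod]

theorem swapTR_markWeight_odd (c : ℕ) : swapTR (markWeight (2 * c + 1)) = markWeight (2 * c) := by
  simp [markWeight, swapTR, tVar, rVar, Nat.add_mod]

/-- Exchanging `t` and `r` exchanges the weights of `k'` and `k`, which have the consecutive codes
`2 * k` and `2 * k + 1`. -/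
theorem map_swapTR_Qtr {n : ℕ} {mu : YoungDiagram} (h : mu ≤ staircase n) :
    MvPowerSeries.map swapTR (Qtr (staircase n) mu) = Qtr (staircase n) mu := by
  ext1 d
  obtain ⟨m, hm⟩ := exists_forall_mem_support_lt d
  rw [MvPowerSeries.coeff_map, coeff_Qtr _ _ d hm, ← MvPowerSeries.coeff_map, map_genFun,
    ← cells_ofDiagram h]
  congr 1
  refine StairRows.genFun_cells_top_swap_weights _ _ _ (fun c => ?_) (fun c => ?_) m _
  · rw [letterWeight, letterWeight, MvPowerSeries.map_monomial, swapTR_markWeight_even,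
      show 2 * c / 2 = (2 * c + 1) / 2 by omega]
  · rw [letterWeight, letterWeight, MvPowerSeries.map_monomial, swapTR_markWeight_odd,
      show (2 * c + 1) / 2 = 2 * c / 2 by omega]

/-- Reflection in the diagonal fixes `δ` and exchanges the kinds of the letters; `genFun_cells_top`
restores them. -/
theorem Qtr_transpose {n : ℕ} {mu : YoungDiagram} (h : mu ≤ staircase n) :
    Qtr (staircase n) mu.transpose = Qtr (staircase n) mu := by
  ext1 d
  obtain ⟨m, hm⟩ := exists_forall_mem_support_lt d
  rw [coeff_Qtr _ _ d hm, coeff_Qtr _ _ d hm,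
    genFun_reflectDiag _ _ (fun _ => rfl) fun i j => mem_skewCells_transpose,
    ← cells_ofDiagram h, StairRows.genFun_cells_top _ letterKind]

/-! ### Shifted diagrams -/

/-- A bijection between diagrams that preserves and reflects the relations between boxes in a
common row or column. -/
structure IsRearrangement {S S' : Finset (ℕ × ℕ)} (e : S ≃ S') : Prop where
  row_eq : ∀ a b, (e a).1.1 = (e b).1.1 ↔ a.1.1 = b.1.1
  row_lt : ∀ a b, (e a).1.1 < (e b).1.1 ↔ a.1.1 < b.1.1
  col_eq : ∀ a b, (e a).1.2 = (e b).1.2 ↔ a.1.2 = b.1.2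
  col_lt : ∀ a b, (e a).1.2 < (e b).1.2 ↔ a.1.2 < b.1.2

theorem IsRearrangement.symm {S S' : Finset (ℕ × ℕ)} {e : S ≃ S'} (h : IsRearrangement e) :
    IsRearrangement e.symm where
  row_eq a b := by rw [← h.row_eq, e.apply_symm_apply, e.apply_symm_apply]
  row_lt a b := by rw [← h.row_lt, e.apply_symm_apply, e.apply_symm_apply]
  col_eq a b := by rw [← h.col_eq, e.apply_symm_apply, e.apply_symm_apply]
  col_lt a b := by rw [← h.col_lt, e.apply_symm_apply, e.apply_symm_apply]

/-- Transport of a marked tableau along a rearrangement of its boxes. -/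
def QTableau.comap {S S' : Finset (ℕ × ℕ)} {e : S ≃ S'} (h : IsRearrangement e)
    (T : QTableau S') : QTableau S where
  entry a := T.entry (e a)
  row_weak a b h₁ h₂ := T.row_weak _ _ ((h.row_eq a b).2 h₁) ((h.col_lt a b).2 h₂)
  col_weak a b h₁ h₂ := T.col_weak _ _ ((h.col_eq a b).2 h₁) ((h.row_lt a b).2 h₂)
  row_primed a b h₁ h₂ := T.row_primed _ _ ((h.row_eq a b).2 h₁) ((h.col_lt a b).2 h₂)
  col_unprimed a b h₁ h₂ := T.col_unprimed _ _ ((h.col_eq a b).2 h₁) ((h.row_lt a b).2 h₂)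

theorem QTableau.wt_comap {S S' : Finset (ℕ × ℕ)} {e : S ≃ S'} (h : IsRearrangement e)
    (T : QTableau S') : (T.comap h).wt = T.wt :=
  Fintype.sum_equiv e _ _ fun _ => rfl

theorem ncard_wt_eq_of_isRearrangement {S S' : Finset (ℕ × ℕ)} {e : S ≃ S'}
    (h : IsRearrangement e) (d : ℕ →₀ ℕ) :
    Set.ncard {T : QTableau S' | T.wt = d} = Set.ncard {T : QTableau S | T.wt = d} := by
  refine Set.ncard_congr (fun T _ => T.comap h) (fun T hT => (T.wt_comap h).trans hT) ?_ ?_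
  · intro T T' _ _ heq
    ext a
    simpa [QTableau.comap] using congrFun (congrArg QTableau.entry heq) (e.symm a)
  · intro T hT
    refine ⟨T.comap h.symm, (T.wt_comap h.symm).trans hT, ?_⟩
    ext a
    simp [QTableau.comap]

/-- For `i < n`, the shift by `i` cancels against the part `n - i` of `δ`: row `i` starts at column
`i + (μ_i + n - i) = n + μ_i` and stops before `i + 2(n - i) = n + (n - i)`. -/
theorem mem_shiftedCells_sdiff {n : ℕ} {mu : YoungDiagram} (h : mu ≤ staircase n) {i j : ℕ} :
    (i, j) ∈ (addStaircase n (staircase n) (colLen_le_of_le_staircase le_rfl)).shiftedCells \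
        (addStaircase n mu (colLen_le_of_le_staircase h)).shiftedCells ↔
      n ≤ j ∧ (i, j - n) ∈ skewCells (staircase n) mu := by
  have := (StairRows.ofDiagram h).row_le i
  simp only [StairRows.ofDiagram] at this
  rw [Finset.mem_sdiff, StrictPartition.mem_shiftedCells, StrictPartition.mem_shiftedCells,
    mem_skewCells_staircase]
  simp only [addStaircase, rowLen_staircase]
  omega

/-- The shifted diagram `(δ + δ)/(μ + δ)` is the diagram `δ/μ`, translated by `n` columns. -/
theorem exists_isRearrangement {n : ℕ} {mu : YoungDiagram} (h : mu ≤ staircase n) :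
    ∃ e : skewCells (staircase n) mu ≃
      ((addStaircase n (staircase n) (colLen_le_of_le_staircase le_rfl)).shiftedCells \
        (addStaircase n mu (colLen_le_of_le_staircase h)).shiftedCells : Finset (ℕ × ℕ)),
      IsRearrangement e := by
  refine ⟨⟨fun a => ⟨(a.1.1, a.1.2 + n), ?_⟩, fun a => ⟨(a.1.1, a.1.2 - n), ?_⟩, ?_, ?_⟩, ?_⟩
  · rw [mem_shiftedCells_sdiff h, Nat.add_sub_cancel]
    exact ⟨Nat.le_add_left _ _, a.2⟩
  · exact ((mem_shiftedCells_sdiff h).1 a.2).2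
  · intro a
    simp
  · intro a
    have := ((mem_shiftedCells_sdiff h).1 a.2).1
    simp [Nat.sub_add_cancel this]
  · constructor <;> simp

/-- At `t = r = 1` every tableau contributes `1`. -/
theorem ncard_wt_eq {lam mu : YoungDiagram} (d : ℕ →₀ ℕ) :
    (Set.ncard {T : QTableau (skewCells lam mu) | T.wt = d} : ℤ) =
      MvPolynomial.eval (fun _ => 1) (MvPowerSeries.coeff d (Qtr lam mu)) := by
  change _ = MvPolynomial.eval (fun _ => 1)
    (∑ᶠ T ∈ {T : QTableau (skewCells lam mu) | T.wt = d},
      tVar ^ T.numPrimed * rVar ^ T.numUnprimed)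
  rw [finsum_mem_eq_finite_toFinset_sum _ (QTableau.finite_wt_eq d), map_sum,
    Set.ncard_eq_toFinset_card _ (QTableau.finite_wt_eq d)]
  simp [tVar, rVar]

theorem skewQ_addStaircase {n : ℕ} {mu : YoungDiagram} (h : mu ≤ staircase n) (d : ℕ →₀ ℕ) :
    skewQ (addStaircase n (staircase n) (colLen_le_of_le_staircase le_rfl))
        (addStaircase n mu (colLen_le_of_le_staircase h)) d =
      MvPolynomial.eval (fun _ => 1) (MvPowerSeries.coeff d (Qtr (staircase n) mu)) := by
  obtain ⟨e, he⟩ := exists_isRearrangement h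
  rw [skewQ, ncard_wt_eq_of_isRearrangement he, ncard_wt_eq]

end QSchur

end

theorem mainTheorem8 (n : ℕ) (mu : YoungDiagram) (hmu : mu ≤ QSchur.staircase n) :
    MvPowerSeries.map QSchur.swapTR (QSchur.Qtr (QSchur.staircase n) mu) =
        QSchur.Qtr (QSchur.staircase n) mu ∧
      QSchur.Qtr (QSchur.staircase n) mu = QSchur.Qtr (QSchur.staircase n) mu.transpose ∧
      QSchur.skewQ
          (QSchur.addStaircase n (QSchur.staircase n) (QSchur.colLen_le_of_le_staircase le_rfl))
          (QSchur.addStaircase n mu (QSchur.colLen_le_of_le_staircase hmu)) =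
        QSchur.skewQ
          (QSchur.addStaircase n (QSchur.staircase n) (QSchur.colLen_le_of_le_staircase le_rfl))
          (QSchur.addStaircase n mu.transpose
            (QSchur.colLen_le_of_le_staircase (QSchur.transpose_le_staircase hmu))) := by
  refine ⟨QSchur.map_swapTR_Qtr hmu, (QSchur.Qtr_transpose hmu).symm, funext fun d => ?_⟩
  rw [QSchur.skewQ_addStaircase hmu, QSchur.skewQ_addStaircase (QSchur.transpose_le_staircase hmu),
    QSchur.Qtr_transpose hmu]
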